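/- **Corollary (Information preservation).** Let $n,m$ be integers and $\epsilon_{\mathcal S}>0$. Let $\mathfrak C\subset\mathbb R^{n\times n\times n\times n}$ be the space of fourth order cumulant tensors, i.e. of tensors invariant under all permutations of their four indices, with the Frobenius norm $\lVert\cdot\rVert_F$. Let $p=\binom{n+3}{4}$ and let $\mathrm{vec}:\mathfrak C\to\mathbb R^{p}$ be the vectorization that lists the entries $\mathcal Z_{ijkl}$ with $i\le j\le k\le l$, each multiplied by the square root of the number of distinct rearrangements of $(i,j,k,l)$, so that $\lVert \mathrm{vec}(\mathcal Z)\rVert_2=\lVert\mathcal Z\rVert_F$. Let $\mathfrak D$ be the set of diagonal tensors $\mathcal S$ ($\mathcal S_{ijkl}=0$ unless $i=j=k=l$) with $\mathcal S_{iiii}\ge\epsilon_{\mathcal S}$ for all $i$, and let the model set be $$\mathfrak S=\{\mathcal S\times_1\mathbf Q\times_2\mathbf Q\times_3\mathbf Q\times_4\mathbf Q:\ \mathcal S\in\mathfrak D,\ \mathbf Q\in\mathbb R^{n\times n},\ \mathbf Q^{T}\mathbf Q=I\}\subset\mathfrak C,$$ where $\times_j$ is the mode-$j$ product. For $\mathbf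 A\in\mathbb R^{m\times p}$ put $\mathcal A(\mathcal Z)=\mathbf A\,\mathrm{vec}(\mathcal Z)$. Let $\delta\in(0,1)$, and let $\mathbf A$ be a random $m\times p$ matrix that satisfies the restricted isometry property on $\mathfrak S$ with constant $\delta$ and probability at least $1-\xi$; that is, with probability at least $1-\xi$, $$(1-\delta)\lVert\mathcal Z_1-\mathcal Z_2\rVert_F^2\le\lVert\mathcal A(\mathcal Z_1-\mathcal Z_2)\rVert_2^2\le(1+\delta)\lVert\mathcal Z_1-\mathcal Z_2\rVert_F^2\qquad\text{for all }\mathcal Z_1,\mathcal Z_2\in\mathfrak S.$$ Then there is an event of probability at least $1-\xi$ on which the following holds simultaneously for all $\mathcal Z^*\in\mathfrak C$ and all $\mathbf e\in\mathbb R^m$. Put $\mathbf y=\mathcal A(\mathcal Z^*)+\mathbf e$. The constrained $\ell_2$ decoding problem $\min_{\mathcal Z\in\mathfrak S}\lVert\mathbf y-\mathcal A(\mathcal Z)\rVert_2$ has a solution, the minimum on the right-hand side below is attained, and every solution $\tilde{\mathcal Z}$ satisfies, for every $\nu\in(0,1]$, $$\lVert\mathcal Z^*-\tilde{\mathcal Z}\rVert_F\le\min_{\mathcal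 Z\in\mathfrak S}\Big(2\lVert\mathcal Z^*-\mathcal Z\rVert_F+\frac{2}{\sqrt{1-\delta}}\lVert\mathbf A\,\mathrm{vec}(\mathcal Z^*-\mathcal Z)\rVert_2\Big)+\frac{2}{\sqrt{1-\delta}}\lVert\mathbf e\rVert_2+\nu .$$ In other words, the constrained $\ell_2$ decoder is instance optimal. -/

import Mathlib

open MeasureTheory

noncomputable section

/-- Real tensors of order four on `ℝⁿ`. The entry at the multi-index `(i, j, k, l)` is `Z ![i, j, k, l]`,
and the norm is the Frobenius norm. -/
abbrev Tensor4 (n : ℕ) : Type := EuclideanSpace ℝ (Fin 4 → Fin n)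

/-- The space of fourth order cumulant tensors: the tensors with the symmetry of a fourth order
cumulant, that is, invariant under every permutation of the four indices. -/
def cumulantSpace (n : ℕ) : Submodule ℝ (Tensor4 n) where
  carrier := {Z | ∀ (σ : Equiv.Perm (Fin 4)) (i : Fin 4 → Fin n), Z (i ∘ σ) = Z i}
  add_mem' := by
    intro Z W hZ hW σ i
    simp [hZ σ i, hW σ i]
  zero_mem' := by
    intro σ i
    simp
  smul_mem' := by
    intro c Z hZ σ i
    simp [hZ σ i]

/-- The mode-`j` product of a tensor with a matrix. -/
def modeProduct {n : ℕ} (j : Fin 4) (Z : Tensor4 n) (Q : Matrix (Fin n) (Fin n) ℝ) : Tensor4 n :=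
  WithLp.toLp 2 fun i => ∑ a : Fin n, Q (i j) a * Z (Function.update i j a)

/-- The diagonal tensors all of whose diagonal entries are at least `εS`. -/
def diagonalTensors (n : ℕ) (εS : ℝ) : Set (Tensor4 n) :=
  {S | (∀ i : Fin 4 → Fin n, (∀ a : Fin n, i ≠ fun _ => a) → S i = 0) ∧
    ∀ a : Fin n, εS ≤ S fun _ => a}

/-- The model set of independent component analysis: the tensors that an orthogonal change of
coordinates, applied in all four modes, makes diagonal with diagonal entries at least `εS`. -/
def modelSet (n : ℕ) (εS : ℝ) : Set (Tensor4 n) :=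
  {Z | ∃ S ∈ diagonalTensors n εS, ∃ Q : Matrix (Fin n) (Fin n) ℝ, Q.transpose * Q = 1 ∧
    Z = modeProduct 3 (modeProduct 2 (modeProduct 1 (modeProduct 0 S Q) Q) Q) Q}

/-- The multi-indices `i ≤ j ≤ k ≤ l`: one for each of the `(n + 3).choose 4` entries by which a
symmetric tensor is determined. -/
abbrev VecIndex (n : ℕ) : Type := {i : Fin 4 → Fin n // Monotone i}

/-- The number of distinct rearrangements of a multi-index. -/
def numRearrangements {n : ℕ} (i : Fin 4 → Fin n) : ℕ :=
  (Finset.univ.image fun σ : Equiv.Perm (Fin 4) => i ∘ σ).card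

/-- Vectorization of a symmetric tensor by its `(n + 3).choose 4` free entries. Each entry carries the
weight (the square root of its number of occurrences in the tensor) that turns the Frobenius norm into
the Euclidean norm. -/
def tensorVec {n : ℕ} (Z : Tensor4 n) : EuclideanSpace ℝ (VecIndex n) :=
  WithLp.toLp 2 fun i => Real.sqrt (numRearrangements i.1) * Z i.1

/-- The sketching operator `Z ↦ A vec(Z)`. -/
def sketch {n m : ℕ} (A : Matrix (Fin m) (VecIndex n) ℝ) (Z : Tensor4 n) :
    EuclideanSpace ℝ (Fin m) :=
  WithLp.toLp 2 (A.mulVec (tensorVec Z).ofLp)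

/-- The restricted isometry property with constant `δ` of the sketching operator on the model set. -/
def SatisfiesRIP {n m : ℕ} (εS δ : ℝ) (A : Matrix (Fin m) (VecIndex n) ℝ) : Prop :=
  ∀ Z₁ ∈ modelSet n εS, ∀ Z₂ ∈ modelSet n εS,
    (1 - δ) * ‖Z₁ - Z₂‖ ^ 2 ≤ ‖sketch A (Z₁ - Z₂)‖ ^ 2 ∧
      ‖sketch A (Z₁ - Z₂)‖ ^ 2 ≤ (1 + δ) * ‖Z₁ - Z₂‖ ^ 2

/-- The possible outputs of the constrained `ℓ₂` decoder: the minimizers of `‖y - A vec(Z)‖₂` over the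
model set. -/
def decoder {n m : ℕ} (εS : ℝ) (A : Matrix (Fin m) (VecIndex n) ℝ) (y : EuclideanSpace ℝ (Fin m)) :
    Set (Tensor4 n) :=
  {Z | Z ∈ modelSet n εS ∧ ∀ W ∈ modelSet n εS, ‖y - sketch A Z‖ ≤ ‖y - sketch A W‖}

end

/-! The lower RIP bound makes the sketch injective on the model set, with inverse Lipschitz constant
`1 / √(1 - δ)`. For `W` in the model set, the triangle inequality through `W` leaves `‖W - Ztilde‖`,
which is at most `1 / √(1 - δ)` times the sum of the residuals of `W` and `Ztilde`. Minimality
bounds both by the residual of `W`, hence by `‖sketch A (Zstar - W)‖ + ‖e‖`. Both minima exist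
because the model set is closed (the orthogonal group is compact) and both objectives grow at least
linearly on it. -/

open Filter Topology in
/-- A continuous function on a closed subset of a proper space attains its minimum there if it grows
at least linearly. -/
theorem exists_isMinOn_of_linear_growth {E : Type*} [NormedAddCommGroup E] [ProperSpace E]
    {s : Set E} (hs : IsClosed s) {x₀ : E} (hx₀ : x₀ ∈ s) {f : E → ℝ} (hf : Continuous f)
    {c K : ℝ} (hc : 0 < c) (hgrow : ∀ x ∈ s, c * ‖x‖ - K ≤ f x) :
    ∃ x ∈ s, IsMinOn f s x := by
  refine hf.continuousOn.exists_isMinOn' hs hx₀ ?_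
  rw [eventually_inf_principal]
  filter_upwards [(tendsto_norm_cocompact_atTop (E := E)).eventually_ge_atTop ((f x₀ + K) / c)]
    with x hx hxs
  rw [div_le_iff₀ hc] at hx
  have := hgrow x hxs
  linarith

theorem modeProduct_apply {n : ℕ} (j : Fin 4) (Z : Tensor4 n) (Q : Matrix (Fin n) (Fin n) ℝ)
    (i : Fin 4 → Fin n) :
    modeProduct j Z Q i = ∑ a : Fin n, Q (i j) a * Z (Function.update i j a) := rfl

theorem modeProduct_modeProduct {n : ℕ} (j : Fin 4) (Z : Tensor4 n)
    (Q R : Matrix (Fin n) (Fin n) ℝ) :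
    modeProduct j (modeProduct j Z Q) R = modeProduct j Z (R * Q) := by
  ext i
  simp only [modeProduct_apply, Matrix.mul_apply, Finset.mul_sum, Finset.sum_mul,
    Function.update_self, Function.update_idem]
  rw [Finset.sum_comm]
  simp only [mul_assoc]

theorem modeProduct_one {n : ℕ} (j : Fin 4) (Z : Tensor4 n) : modeProduct j Z 1 = Z := by
  ext i
  simp [modeProduct_apply, Matrix.one_apply]

theorem modeProduct_comm {n : ℕ} {j k : Fin 4} (hjk : j ≠ k) (Z : Tensor4 n)
    (Q R : Matrix (Fin n) (Fin n) ℝ) :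
    modeProduct j (modeProduct k Z Q) R = modeProduct k (modeProduct j Z R) Q := by
  ext i
  simp only [modeProduct_apply, Finset.mul_sum, Function.update_of_ne hjk,
    Function.update_of_ne hjk.symm]
  rw [Finset.sum_comm]
  refine Finset.sum_congr rfl fun a _ => Finset.sum_congr rfl fun b _ => ?_
  rw [Function.update_comm hjk]
  ring

/-- The change of coordinates `Q` applied in all four modes. -/
def congruence {n : ℕ} (Z : Tensor4 n) (Q : Matrix (Fin n) (Fin n) ℝ) : Tensor4 n :=
  modeProduct 3 (modeProduct 2 (modeProduct 1 (modeProduct 0 Z Q) Q) Q) Q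

theorem congruence_one {n : ℕ} (Z : Tensor4 n) : congruence Z 1 = Z := by
  simp only [congruence, modeProduct_one]

theorem congruence_congruence {n : ℕ} (Z : Tensor4 n) (Q R : Matrix (Fin n) (Fin n) ℝ) :
    congruence (congruence Z Q) R = congruence Z (R * Q) := by
  simp only [congruence]
  -- Products in different modes commute, so each `R` can be moved next to the `Q` of its own mode.
  rw [modeProduct_comm (j := 0) (k := 3) (by decide),
    modeProduct_comm (j := 0) (k := 2) (by decide),
    modeProduct_comm (j := 0) (k := 1) (by decide), modeProduct_modeProduct 0,
    modeProduct_comm (j := 1) (k := 3) (by decide),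
    modeProduct_comm (j := 1) (k := 2) (by decide), modeProduct_modeProduct 1,
    modeProduct_comm (j := 2) (k := 3) (by decide), modeProduct_modeProduct 2,
    modeProduct_modeProduct 3]

theorem Continuous.modeProduct {X : Type*} [TopologicalSpace X] {n : ℕ} (j : Fin 4)
    {Z : X → Tensor4 n} {Q : X → Matrix (Fin n) (Fin n) ℝ} (hZ : Continuous Z)
    (hQ : Continuous Q) : Continuous fun x => modeProduct j (Z x) (Q x) := by
  refine (PiLp.continuous_toLp 2 _).comp (continuous_pi fun i => ?_)
  refine continuous_finsetSum _ fun a _ => ?_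
  exact (hQ.matrix_elem _ _).mul ((PiLp.continuous_apply 2 _ _).comp hZ)

theorem Continuous.congruence {X : Type*} [TopologicalSpace X] {n : ℕ}
    {Z : X → Tensor4 n} {Q : X → Matrix (Fin n) (Fin n) ℝ} (hZ : Continuous Z)
    (hQ : Continuous Q) : Continuous fun x => congruence (Z x) (Q x) :=
  (((hZ.modeProduct 0 hQ).modeProduct 1 hQ).modeProduct 2 hQ).modeProduct 3 hQ

theorem isClosed_diagonalTensors (n : ℕ) (εS : ℝ) : IsClosed (diagonalTensors n εS) := by
  have h : ∀ i : Fin 4 → Fin n, Continuous fun S : Tensor4 n => S i :=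
    fun i => PiLp.continuous_apply 2 _ i
  simp only [diagonalTensors, Set.ofPred_and, Set.ofPred_forall]
  exact (isClosed_iInter fun i => isClosed_iInter fun _ => isClosed_eq (h i) continuous_const).inter
    (isClosed_iInter fun a => isClosed_le continuous_const (h _))

theorem isCompact_orthogonal (n : ℕ) :
    IsCompact {Q : Matrix (Fin n) (Fin n) ℝ | Q.transpose * Q = 1} := by
  have hbox : IsCompact (Set.univ.pi fun _ : Fin n => Set.univ.pi fun _ : Fin n =>
      Set.Icc (-1 : ℝ) 1) :=
    isCompact_univ_pi fun _ => isCompact_univ_pi fun _ => isCompact_Icc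
  refine IsCompact.of_isClosed_subset hbox ?_ ?_
  · exact isClosed_eq (continuous_id.matrix_transpose.matrix_mul continuous_id) continuous_const
  · intro Q hQ i _ j _
    -- Columns have unit length, so every entry lies in `[-1, 1]`.
    have hjj : ∑ k, Q k j * Q k j = 1 := by
      simpa [Matrix.mul_apply] using congrFun (congrFun hQ j) j
    have hij : Q i j * Q i j ≤ 1 := hjj ▸ Finset.single_le_sum
      (f := fun k => Q k j * Q k j) (fun k _ => mul_self_nonneg _) (Finset.mem_univ i)
    exact ⟨by nlinarith, by nlinarith⟩

/-- Undoing `Q` by its transpose leaves a quantifier over a compact set only, as closedness of the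
model set requires. -/
theorem mem_modelSet_iff {n : ℕ} {εS : ℝ} {Z : Tensor4 n} :
    Z ∈ modelSet n εS ↔ ∃ Q : Matrix (Fin n) (Fin n) ℝ, Q.transpose * Q = 1 ∧
      congruence Z Q.transpose ∈ diagonalTensors n εS := by
  constructor
  · rintro ⟨S, hS, Q, hQ, rfl⟩
    refine ⟨Q, hQ, ?_⟩
    change congruence (congruence S Q) Q.transpose ∈ _
    rwa [congruence_congruence, hQ, congruence_one]
  · rintro ⟨Q, hQ, hS⟩
    refine ⟨_, hS, Q, hQ, ?_⟩
    change Z = congruence (congruence Z Q.transpose) Q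
    rw [congruence_congruence, mul_eq_one_comm.mp hQ, congruence_one]

/-- Projection along a compact factor is a closed map. -/
theorem isClosed_modelSet (n : ℕ) (εS : ℝ) : IsClosed (modelSet n εS) := by
  let O := {Q : Matrix (Fin n) (Fin n) ℝ | Q.transpose * Q = 1}
  have : CompactSpace O := isCompact_iff_compactSpace.mp (isCompact_orthogonal n)
  have hcont : Continuous fun p : Tensor4 n × O => congruence p.1 p.2.1.transpose :=
    continuous_fst.congruence (continuous_subtype_val.comp continuous_snd).matrix_transpose
  convert isClosedMap_fst_of_compactSpace _ ((isClosed_diagonalTensors n εS).preimage hcont)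
  ext Z
  rw [mem_modelSet_iff]
  constructor
  · rintro ⟨Q, hQ, h⟩
    exact ⟨(Z, ⟨Q, hQ⟩), h, rfl⟩
  · rintro ⟨⟨_, Q⟩, h, rfl⟩
    exact ⟨Q.1, Q.2, h⟩

theorem modelSet_nonempty (n : ℕ) (εS : ℝ) : (modelSet n εS).Nonempty := by
  classical
  let S : Tensor4 n := WithLp.toLp 2 fun i => if ∃ a, i = fun _ => a then εS else 0
  refine ⟨S, mem_modelSet_iff.mpr ⟨1, by simp, ?_⟩⟩
  rw [Matrix.transpose_one, congruence_one]
  refine ⟨fun i hi => if_neg ?_, fun a => (if_pos ⟨a, rfl⟩).ge⟩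
  rintro ⟨a, ha⟩
  exact hi a ha

theorem sketch_sub {n m : ℕ} (A : Matrix (Fin m) (VecIndex n) ℝ) (Z W : Tensor4 n) :
    sketch A (Z - W) = sketch A Z - sketch A W := by
  have h : tensorVec (Z - W) = tensorVec Z - tensorVec W := by
    ext i
    exact mul_sub _ _ _
  ext i
  simp only [sketch, h, WithLp.ofLp_sub, Matrix.mulVec_sub]

theorem Continuous.sketch {X : Type*} [TopologicalSpace X] {n m : ℕ}
    {A : X → Matrix (Fin m) (VecIndex n) ℝ} {Z : X → Tensor4 n} (hA : Continuous A)
    (hZ : Continuous Z) : Continuous fun x => sketch (A x) (Z x) := by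
  refine (PiLp.continuous_toLp 2 _).comp (hA.matrix_mulVec (continuous_pi fun i => ?_))
  exact continuous_const.mul ((PiLp.continuous_apply 2 _ _).comp hZ)

/-- RIP may impose uncountably many conditions; closedness, unlike measurability, survives their
intersection. -/
theorem isClosed_setOf_satisfiesRIP (n m : ℕ) (εS δ : ℝ) :
    IsClosed {A : Matrix (Fin m) (VecIndex n) ℝ | SatisfiesRIP εS δ A} := by
  have h : ∀ Z : Tensor4 n, Continuous fun A : Matrix (Fin m) (VecIndex n) ℝ =>
      ‖sketch A Z‖ ^ 2 := fun Z => (continuous_id.sketch continuous_const).norm.pow 2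
  simp only [SatisfiesRIP, Set.ofPred_forall, Set.ofPred_and]
  exact isClosed_iInter fun Z₁ => isClosed_iInter fun _ => isClosed_iInter fun Z₂ =>
    isClosed_iInter fun _ => (isClosed_le continuous_const (h _)).inter
      (isClosed_le (h _) continuous_const)

theorem measurableSet_satisfiesRIP {Ω : Type*} [MeasurableSpace Ω] {n m : ℕ} (εS δ : ℝ)
    {A : Ω → Matrix (Fin m) (VecIndex n) ℝ} (hA : ∀ i j, Measurable fun ω => A ω i j) :
    MeasurableSet {ω | SatisfiesRIP εS δ (A ω)} := by
  let B : Ω → Fin m → VecIndex n → ℝ := A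
  have hB : Measurable B := measurable_pi_lambda _ fun i => measurable_pi_lambda _ fun j => hA i j
  have hc : IsClosed {A : Fin m → VecIndex n → ℝ | SatisfiesRIP εS δ A} :=
    isClosed_setOf_satisfiesRIP n m εS δ
  exact hB hc.measurableSet

theorem SatisfiesRIP.sqrt_mul_norm_sub_le {n m : ℕ} {εS δ : ℝ}
    {A : Matrix (Fin m) (VecIndex n) ℝ} (hA : SatisfiesRIP εS δ A) (hδ : δ < 1)
    {Z W : Tensor4 n} (hZ : Z ∈ modelSet n εS) (hW : W ∈ modelSet n εS) :
    Real.sqrt (1 - δ) * ‖Z - W‖ ≤ ‖sketch A (Z - W)‖ := by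
  refine le_of_sq_le_sq ?_ (norm_nonneg _)
  rw [mul_pow, Real.sq_sqrt (by linarith)]
  exact (hA Z hZ W hW).1

theorem SatisfiesRIP.decoder_nonempty {n m : ℕ} {εS δ : ℝ}
    {A : Matrix (Fin m) (VecIndex n) ℝ} (hA : SatisfiesRIP εS δ A) (hδ : δ < 1)
    (y : EuclideanSpace ℝ (Fin m)) : (decoder εS A y).Nonempty := by
  obtain ⟨W, hW⟩ := modelSet_nonempty n εS
  have hs : 0 < Real.sqrt (1 - δ) := Real.sqrt_pos.mpr (by linarith)
  obtain ⟨Z, hZ, hmin⟩ := exists_isMinOn_of_linear_growth (isClosed_modelSet n εS) hW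
    (f := fun Z => ‖y - sketch A Z‖)
    (continuous_const.sub (continuous_const.sketch continuous_id)).norm
    -- The sketch may have a kernel; the growth comes from RIP applied to `Z` and the fixed point
    -- `W`.
    (K := Real.sqrt (1 - δ) * ‖W‖ + ‖y - sketch A W‖) hs (fun Z hZ => by
      have h₁ := hA.sqrt_mul_norm_sub_le hδ hZ hW
      have h₂ : ‖sketch A (Z - W)‖ ≤ ‖y - sketch A W‖ + ‖y - sketch A Z‖ := by
        rw [sketch_sub, ← sub_sub_sub_cancel_left _ _ y]
        exact norm_sub_le _ _
      have h₃ := mul_le_mul_of_nonneg_left (norm_sub_norm_le Z W) hs.le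
      rw [mul_sub] at h₃
      linarith)
  exact ⟨Z, hZ, fun V hV => hmin hV⟩

theorem SatisfiesRIP.norm_sub_decoder_le {n m : ℕ} {εS δ : ℝ}
    {A : Matrix (Fin m) (VecIndex n) ℝ} (hA : SatisfiesRIP εS δ A) (hδ : δ < 1)
    (Zstar : Tensor4 n) (e : EuclideanSpace ℝ (Fin m)) {Ztilde W : Tensor4 n}
    (hZ : Ztilde ∈ decoder εS A (sketch A Zstar + e)) (hW : W ∈ modelSet n εS) :
    ‖Zstar - Ztilde‖ ≤ ‖Zstar - W‖ +
      2 / Real.sqrt (1 - δ) * ‖sketch A (Zstar - W)‖ + 2 / Real.sqrt (1 - δ) * ‖e‖ := by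
  have hs : 0 < Real.sqrt (1 - δ) := Real.sqrt_pos.mpr (by linarith)
  set y := sketch A Zstar + e with hy
  have h₁ := hA.sqrt_mul_norm_sub_le hδ hW hZ.1
  have h₂ : ‖sketch A (W - Ztilde)‖ ≤ ‖y - sketch A Ztilde‖ + ‖y - sketch A W‖ := by
    rw [sketch_sub, ← sub_sub_sub_cancel_left _ _ y]
    exact norm_sub_le _ _
  have h₃ : ‖y - sketch A W‖ ≤ ‖sketch A (Zstar - W)‖ + ‖e‖ := by
    rw [sketch_sub, hy, add_sub_right_comm]
    exact norm_add_le _ _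
  have h₄ := hZ.2 W hW
  have h₅ : ‖W - Ztilde‖ ≤ 2 / Real.sqrt (1 - δ) * (‖sketch A (Zstar - W)‖ + ‖e‖) := by
    rw [div_mul_eq_mul_div, le_div_iff₀ hs]
    linarith
  have h₆ := norm_sub_le_norm_sub_add_norm_sub Zstar W Ztilde
  linarith

theorem exists_isLeast_instanceBound {n m : ℕ} (εS : ℝ) {c : ℝ} (hc : 0 ≤ c)
    (A : Matrix (Fin m) (VecIndex n) ℝ) (Zstar : Tensor4 n) :
    ∃ b : ℝ, IsLeast ((fun Z : Tensor4 n =>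
      2 * ‖Zstar - Z‖ + c * ‖sketch A (Zstar - Z)‖) '' modelSet n εS) b := by
  obtain ⟨W, hW⟩ := modelSet_nonempty n εS
  have hsub : Continuous fun Z : Tensor4 n => Zstar - Z := continuous_const.sub continuous_id
  obtain ⟨Z, hZ, hmin⟩ := exists_isMinOn_of_linear_growth (isClosed_modelSet n εS) hW
    (f := fun Z => 2 * ‖Zstar - Z‖ + c * ‖sketch A (Zstar - Z)‖)
    ((continuous_const.mul hsub.norm).add
      (continuous_const.mul (continuous_const.sketch hsub).norm))
    -- The first term alone gives the growth, so RIP plays no role here.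
    (K := 2 * ‖Zstar‖) two_pos (fun Z _ => by
      have h₁ := norm_sub_norm_le Z Zstar
      rw [norm_sub_rev] at h₁
      have h₂ := mul_nonneg hc (norm_nonneg (sketch A (Zstar - Z)))
      linarith)
  exact ⟨_, ⟨Z, hZ, rfl⟩, Set.forall_mem_image.mpr fun V hV => hmin hV⟩

theorem corollary1 {Ω : Type*} [MeasurableSpace Ω] (P : Measure Ω) [IsProbabilityMeasure P]
    (n m : ℕ) (εS δ ξ : ℝ) (hεS : 0 < εS) (hδ : 0 < δ) (hδ' : δ < 1)
    (A : Ω → Matrix (Fin m) (VecIndex n) ℝ)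
    (hA : ∀ i j, Measurable fun ω => A ω i j)
    (hRIP : ENNReal.ofReal (1 - ξ) ≤ P {ω | SatisfiesRIP εS δ (A ω)}) :
    ∃ E : Set Ω, MeasurableSet E ∧ ENNReal.ofReal (1 - ξ) ≤ P E ∧
      ∀ ω ∈ E, ∀ Zstar ∈ cumulantSpace n, ∀ e : EuclideanSpace ℝ (Fin m),
        (decoder εS (A ω) (sketch (A ω) Zstar + e)).Nonempty ∧
        ∃ b : ℝ,
          IsLeast ((fun Z : Tensor4 n =>
            2 * ‖Zstar - Z‖ + 2 / Real.sqrt (1 - δ) * ‖sketch (A ω) (Zstar - Z)‖) ''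
              modelSet n εS) b ∧
          ∀ Ztilde ∈ decoder εS (A ω) (sketch (A ω) Zstar + e), ∀ ν : ℝ, 0 < ν → ν ≤ 1 →
            ‖Zstar - Ztilde‖ ≤ b + 2 / Real.sqrt (1 - δ) * ‖e‖ + ν := by

  refine ⟨_, measurableSet_satisfiesRIP εS δ hA, hRIP, fun ω hω Zstar _ e =>
    ⟨SatisfiesRIP.decoder_nonempty hω hδ' _, ?_⟩⟩
  obtain ⟨b, hb⟩ := exists_isLeast_instanceBound εS
    (div_nonneg zero_le_two (Real.sqrt_nonneg (1 - δ))) (A ω) Zstar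
  refine ⟨b, hb, fun Ztilde hZ ν hν _ => ?_⟩
  obtain ⟨W, hW, rfl⟩ := hb.1
  have h := SatisfiesRIP.norm_sub_decoder_le hω hδ' Zstar e hZ hW
  -- The estimate has coefficient 1 on `‖Zstar - W‖`; the second copy in the bound and `ν` are
  -- slack.
  have := norm_nonneg (Zstar - W)
  dsimp only
  linarith
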